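/- Consider the Gaussian sequence model $y_j=\theta_j+\sigma\xi_j$, $j=1,\dots,d$, where $\theta=(\theta_1,\dots,\theta_d)\in\mathbb R^d$ is unknown, $\xi_1,\dots,\xi_d$ are i.i.d. standard normal random variables and $\sigma>0$. Let $\mathbf E_\theta$ denote expectation with respect to the law of $(y_1,\dots,y_d)$. Let $L(\theta)=\sum_{i=1}^d\theta_i$, let $B_q(r)=\{\theta\in\mathbb R^d:\ (\sum_{i=1}^d|\theta_i|^q)^{1/q}\le r\}$, and for $\Theta\subseteq\mathbb R^d$ let $$R^*_L(\Theta)=\inf_{\hat T}\sup_{\theta\in\Theta}\mathbf E_\theta\big(\hat T-L(\theta)\big)^2,$$ where the infimum is over all estimators, i.e. all measurable real-valued functions $\hat T$ of $(y_1,\dots,y_d)$. Let $S=\{s\in\mathbb N:\ s\ge 1,\ \sigma^2\log(1+d/s^2)\le r^2s^{-2/q}\}$. Put $m=0$ if $S$ is empty, $m=\max S$ if $S$ is non-empty and bounded, and $m=\infty$ if $S$ is unbounded (for $0<q\le 1$ this happens only if $q=1$ and $r^2\ge\sigma^2d$). Define $$\psi^L_{\sigma,q}(r,d)=\begin{cases}\sigma^2m^2\log(1+d/m^2)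 & \text{if } 1\le m<\infty,\\ r^2 & \text{if } m=0,\\ \sigma^2 d & \text{if } m=\infty.\end{cases}$$ Theorem. Let $0<q\le 1$. There exists a constant $c>0$, depending only on $q$, such that for every integer $d\ge 1$ and all $r,\sigma>0$, $$R^*_L(B_q(r))\ \ge\ c\,\psi^L_{\sigma,q}(r,d).$$ -/

import Mathlib

open MeasureTheory ProbabilityTheory
open scoped ENNReal

namespace SparseMinimax

/-- The law `P_θ` of the observation vector `y = (y_1, …, y_d)` in the Gaussian sequence model
`y_j = θ_j + σ ξ_j`, where `ξ_1, …, ξ_d` are i.i.d. standard normal. -/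
noncomputable def obsLaw {d : ℕ} (σ : ℝ) (θ : Fin d → ℝ) : Measure (Fin d → ℝ) :=
  (Measure.pi (fun _ : Fin d => gaussianReal 0 1)).map (fun ξ j => θ j + σ * ξ j)

/-- The linear functional `L(θ) = ∑ θ_i`. -/
def linFun {d : ℕ} (θ : Fin d → ℝ) : ℝ := ∑ i, θ i

/-- The set `B_q(r) = {θ ∈ ℝ^d : ‖θ‖_q ≤ r}`, where `‖θ‖_q = (∑ |θ_i|^q)^(1/q)`. -/
def lqBall (d : ℕ) (q r : ℝ) : Set (Fin d → ℝ) :=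
  {θ | (∑ i, |θ i| ^ q) ^ (1 / q) ≤ r}

/-- The squared risk `E_θ (est - T(θ))^2` of an estimator `est` of `T(θ)`, with values
in `[0, ∞]`. -/
noncomputable def sqRisk {d : ℕ} (σ : ℝ) (T : (Fin d → ℝ) → ℝ)
    (est : (Fin d → ℝ) → ℝ) (θ : Fin d → ℝ) : ℝ≥0∞ :=
  ∫⁻ y, ENNReal.ofReal ((est y - T θ) ^ 2) ∂(obsLaw σ θ)

/-- The minimax risk `R*_T(Θ)`: infimum over all estimators (measurable functions of the
observation) of the maximum squared risk over `Θ`. -/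
noncomputable def minimaxRisk {d : ℕ} (σ : ℝ) (T : (Fin d → ℝ) → ℝ)
    (Θ : Set (Fin d → ℝ)) : ℝ≥0∞ :=
  ⨅ (est : (Fin d → ℝ) → ℝ) (_ : Measurable est), ⨆ θ ∈ Θ, sqRisk σ T est θ

/-- The set of integers `s ≥ 1` such that `σ² log(1 + d/s²) ≤ r² s^(-2/q)`. -/
def sparsitySet (σ q r : ℝ) (d : ℕ) : Set ℕ :=
  {s | 1 ≤ s ∧ σ ^ 2 * Real.log (1 + (d : ℝ) / (s : ℝ) ^ 2) ≤ r ^ 2 * (s : ℝ) ^ (-2 / q)}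

/-- The effective sparsity `m`: the maximum of `sparsitySet` when that set is non-empty and
bounded, and `0` when it is empty (`sSup ∅ = 0` in `ℕ`). It is only used for bounded sets. -/
noncomputable def effSparsity (σ q r : ℝ) (d : ℕ) : ℕ := sSup (sparsitySet σ q r d)

open Classical in
/-- The rate `ψ^L_{σ,q}(r,d)`: it is `r²` if `m = 0` and `σ² m² log(1 + d/m²)` if `m ≥ 1`.
If `sparsitySet` is unbounded (for `σ, r > 0` and `0 < q ≤ 1` this happens exactly when `q = 1`
and `r² ≥ σ² d`), then it has no maximum, `m = ∞`, and the rate is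
`lim_{m → ∞} σ² m² log(1 + d/m²) = σ² d`. -/
noncomputable def linRate (σ q r : ℝ) (d : ℕ) : ℝ :=
  if BddAbove (sparsitySet σ q r d) then
    if effSparsity σ q r d = 0 then r ^ 2
    else σ ^ 2 * (effSparsity σ q r d : ℝ) ^ 2 *
      Real.log (1 + (d : ℝ) / (effSparsity σ q r d : ℝ) ^ 2)
  else σ ^ 2 * d

end SparseMinimax

namespace SparseMinimax

/-! An estimator cannot be accurate both at the origin and under a random `s`-sparse signal whose
mixture law has bounded second moment relative to pure noise (`le_minimaxRisk_of_mixture`). The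
signal puts one spike of height `ρ` at a uniform position in each of `s` disjoint blocks, so
`linFun` equals `s * ρ`. The blocks make coincidences of two signals independent, so the second
moment factorises and stays at most 9 when `ρ² ≤ σ² log(1 + d/s²)` (`sum_exp_agreements`,
`block_length_pow_le`). Hence the risk is at least `(s * ρ)² / 20`. Taking `s = m` and the largest
such `ρ` gives the rate for `1 ≤ m ≤ d`; `m = 0` uses one spike of height `r`; if `m > d` or `m =
∞`, `d` spikes give order `σ² d`. -/

/-! ### Gaussian likelihood ratios -/

lemma pi_withDensity {ι α : Type*} [Fintype ι] [MeasurableSpace α] {μ : Measure α}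
    [IsProbabilityMeasure μ] {h : ι → α → ℝ≥0∞} (hm : ∀ i, Measurable (h i))
    [∀ i, SigmaFinite (μ.withDensity (h i))] :
    Measure.pi (fun i => μ.withDensity (h i)) =
      (Measure.pi (fun _ : ι => μ)).withDensity (fun x => ∏ i, h i (x i)) := by
  refine Measure.pi_eq fun s hs => ?_
  have hind : iIndepFun (fun i (x : ι → α) => (s i).indicator (h i) (x i))
      (Measure.pi (fun _ : ι => μ)) :=
    iIndepFun_pi (X := fun i => (s i).indicator (h i))
      (fun i => ((hm i).indicator (hs i)).aemeasurable)
  rw [withDensity_apply _ (MeasurableSet.univ_pi hs),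
    ← lintegral_indicator (MeasurableSet.univ_pi hs)]
  have hpt : (Set.univ.pi s).indicator (fun x => ∏ i, h i (x i)) =
      fun x : ι → α => ∏ i, (s i).indicator (h i) (x i) := by
    funext x
    by_cases hx : x ∈ Set.univ.pi s
    · rw [Set.indicator_of_mem hx]
      exact Finset.prod_congr rfl fun i _ =>
        (Set.indicator_of_mem (hx i (Set.mem_univ i)) (h i)).symm
    · rw [Set.indicator_of_notMem hx]
      obtain ⟨i, hi⟩ : ∃ i, x i ∉ s i := by simpa [Set.mem_univ_pi] using hx
      exact (Finset.prod_eq_zero (Finset.mem_univ i) (Set.indicator_of_notMem hi _)).symm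
  rw [hpt, lintegral_prod_eq_prod_lintegral_of_indepFun Finset.univ _ hind
    (fun i => ((hm i).indicator (hs i)).comp (measurable_pi_apply i))]
  refine Finset.prod_congr rfl fun i _ => ?_
  rw [withDensity_apply _ (hs i), ← lintegral_indicator (hs i)]
  exact (measurePreserving_eval (fun _ : ι => μ) i).lintegral_comp ((hm i).indicator (hs i))

lemma gaussianReal_eq_withDensity (u : ℝ) :
    gaussianReal u 1 =
      (gaussianReal 0 1).withDensity (fun x => ENNReal.ofReal (Real.exp (u * x - u ^ 2 / 2))) := by
  rw [gaussianReal_of_var_ne_zero _ one_ne_zero, gaussianReal_of_var_ne_zero _ one_ne_zero,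
    ← withDensity_mul _ (measurable_gaussianPDF 0 1) (by fun_prop)]
  congr 1
  funext x
  simp only [Pi.mul_apply, gaussianPDF]
  rw [← ENNReal.ofReal_mul (gaussianPDFReal_nonneg _ _ _)]
  simp only [gaussianPDFReal]
  rw [mul_assoc _ (Real.exp _), ← Real.exp_add]
  congr 3
  push_cast
  ring

/-- The density of `N(u, I)` with respect to `N(0, I)`. -/
noncomputable def gaussLR {d : ℕ} (u x : Fin d → ℝ) : ℝ :=
  Real.exp (∑ i, (u i * x i - u i ^ 2 / 2))

lemma measurable_gaussLR {d : ℕ} (u : Fin d → ℝ) : Measurable (gaussLR u) := by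
  unfold gaussLR; fun_prop

lemma gaussLR_pos {d : ℕ} (u x : Fin d → ℝ) : 0 < gaussLR u x := Real.exp_pos _

lemma lintegral_shift_gaussian {d : ℕ} (u : Fin d → ℝ) {f : (Fin d → ℝ) → ℝ≥0∞}
    (hf : Measurable f) :
    ∫⁻ x, f (u + x) ∂(Measure.pi fun _ : Fin d => gaussianReal 0 1) =
      ∫⁻ x, ENNReal.ofReal (gaussLR u x) * f x
        ∂(Measure.pi fun _ : Fin d => gaussianReal 0 1) := by
  have hmap : (Measure.pi fun _ : Fin d => gaussianReal 0 1).map (fun x => u + x) =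
      Measure.pi (fun i => gaussianReal (u i) 1) := by
    have := Measure.pi_map_pi (μ := fun _ : Fin d => gaussianReal 0 1)
      (f := fun i x => u i + x) (fun i => by fun_prop)
    simp only [gaussianReal_map_const_add, zero_add] at this
    exact this
  rw [← lintegral_map hf (by fun_prop), hmap]
  have hfin : ∀ i, SigmaFinite ((gaussianReal 0 1).withDensity
      (fun x => ENNReal.ofReal (Real.exp (u i * x - u i ^ 2 / 2)))) := fun i => by
    rw [← gaussianReal_eq_withDensity]; infer_instance
  have hdens : (fun x : Fin d → ℝ => ∏ i, ENNReal.ofReal (Real.exp (u i * x i - u i ^ 2 / 2))) =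
      fun x => ENNReal.ofReal (gaussLR u x) := by
    funext x
    rw [gaussLR, Real.exp_sum, ENNReal.ofReal_prod_of_nonneg fun i _ => (Real.exp_pos _).le]
  have hpi : Measure.pi (fun i => gaussianReal (u i) 1) =
      (Measure.pi fun _ : Fin d => gaussianReal 0 1).withDensity
        (fun x => ENNReal.ofReal (gaussLR u x)) := by
    simp_rw [gaussianReal_eq_withDensity (u _)]
    rw [pi_withDensity (h := fun i x => ENNReal.ofReal (Real.exp (u i * x - u i ^ 2 / 2)))
      (fun i => by fun_prop), hdens]
  rw [hpi, lintegral_withDensity_eq_lintegral_mul _ (measurable_gaussLR u).ennreal_ofReal hf]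
  rfl

lemma lintegral_gaussLR {d : ℕ} (u : Fin d → ℝ) :
    ∫⁻ x, ENNReal.ofReal (gaussLR u x) ∂(Measure.pi fun _ : Fin d => gaussianReal 0 1) = 1 := by
  simpa using (lintegral_shift_gaussian u (f := fun _ => 1) measurable_const).symm

lemma gaussLR_mul {d : ℕ} (u v x : Fin d → ℝ) :
    gaussLR u x * gaussLR v x = Real.exp (∑ i, u i * v i) * gaussLR (u + v) x := by
  simp only [gaussLR, ← Real.exp_add, ← Finset.sum_add_distrib, Pi.add_apply]
  congr 1
  exact Finset.sum_congr rfl fun i _ => by ring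

lemma lintegral_gaussLR_mul {d : ℕ} (u v : Fin d → ℝ) :
    ∫⁻ x, ENNReal.ofReal (gaussLR u x * gaussLR v x)
        ∂(Measure.pi fun _ : Fin d => gaussianReal 0 1) =
      ENNReal.ofReal (Real.exp (∑ i, u i * v i)) := by
  simp_rw [gaussLR_mul, ENNReal.ofReal_mul (Real.exp_pos _).le]
  rw [lintegral_const_mul _ (measurable_gaussLR _).ennreal_ofReal, lintegral_gaussLR, mul_one]

/-- Rescaling by `σ` and changing measure puts the risks at all `θ` under one standard Gaussian law,
where they can be compared pointwise. -/
lemma sqRisk_eq {d : ℕ} {σ : ℝ} (hσ : 0 < σ) (L : (Fin d → ℝ) → ℝ) {T : (Fin d → ℝ) → ℝ}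
    (hT : Measurable T) (θ : Fin d → ℝ) :
    sqRisk σ L T θ = ∫⁻ x, ENNReal.ofReal (gaussLR (fun i => θ i / σ) x *
      (T (fun i => σ * x i) - L θ) ^ 2) ∂(Measure.pi fun _ : Fin d => gaussianReal 0 1) := by
  simp_rw [ENNReal.ofReal_mul (gaussLR_pos _ _).le]
  rw [← lintegral_shift_gaussian (fun i => θ i / σ)
    (f := fun x => ENNReal.ofReal ((T (fun i => σ * x i) - L θ) ^ 2)) (by fun_prop),
    sqRisk, obsLaw, lintegral_map (by fun_prop) (by fun_prop)]
  refine lintegral_congr fun x => ?_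
  congr 4
  funext i
  simp only [Pi.add_apply]
  field_simp

/-! ### The origin against a mixture -/

/-- Bayesian two-point bound: the origin against the uniform prior on a finite family of
parameters on which the functional takes a constant value. -/
lemma le_minimaxRisk_of_mixture {d : ℕ} {σ : ℝ} (hσ : 0 < σ) {L : (Fin d → ℝ) → ℝ}
    (hL : L 0 = 0) {Θ : Set (Fin d → ℝ)} (h0 : (0 : Fin d → ℝ) ∈ Θ)
    {ι : Type*} [Fintype ι] [Nonempty ι] (θ : ι → Fin d → ℝ) (hθ : ∀ i, θ i ∈ Θ)
    {Δ : ℝ} (hΔ : 0 < Δ) (hLθ : ∀ i, L (θ i) = Δ) {V : ℝ} (hV : 0 ≤ V)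
    (hchi : ∀ i, ∑ j, Real.exp (∑ k, θ i k / σ * (θ j k / σ)) ≤ V * Fintype.card ι) :
    ENNReal.ofReal (Δ ^ 2 / (2 * (V + 1))) ≤ minimaxRisk σ L Θ := by
  refine le_iInf₂ fun T hT => ?_
  set R := ⨆ θ ∈ Θ, sqRisk σ L T θ with hR
  rcases eq_or_ne R ⊤ with htop | htop
  · rw [htop]; exact le_top
  set γ := Measure.pi fun _ : Fin d => gaussianReal 0 1 with hγ
  set N : ℝ := (Fintype.card ι : ℝ) with hN
  have hNpos : 0 < N := by rw [hN]; exact_mod_cast Fintype.card_pos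
  set u : ι → Fin d → ℝ := fun i k => θ i k / σ with hu
  set S : (Fin d → ℝ) → ℝ := fun x => T (fun i => σ * x i) with hS
  have hSm : Measurable S := by fun_prop
  have hGm := fun i => measurable_gaussLR (u i)
  have hR0 : ∫⁻ x, ENNReal.ofReal (S x ^ 2) ∂γ ≤ R := by
    have h1 : sqRisk σ L T 0 ≤ R := le_iSup₂ (f := fun θ _ => sqRisk σ L T θ) 0 h0
    rw [sqRisk_eq hσ L hT] at h1
    simpa [gaussLR, hL] using h1
  have hRi : ∀ i, ∫⁻ x, ENNReal.ofReal (gaussLR (u i) x * (S x - Δ) ^ 2) ∂γ ≤ R := fun i => by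
    have h1 : sqRisk σ L T (θ i) ≤ R := le_iSup₂ (f := fun θ _ => sqRisk σ L T θ) (θ i) (hθ i)
    rwa [sqRisk_eq hσ L hT, hLθ i] at h1
  set Λ : (Fin d → ℝ) → ℝ := fun x => ∑ i, gaussLR (u i) x with hΛ
  have hΛm : Measurable Λ := by fun_prop
  have hΛ0 : ∀ x, 0 ≤ Λ x := fun x => Finset.sum_nonneg fun i _ => (gaussLR_pos _ _).le
  have hI1 : ∫⁻ x, ENNReal.ofReal (Λ x) ∂γ = ENNReal.ofReal N := by
    simp_rw [hΛ, ENNReal.ofReal_sum_of_nonneg fun i _ => (gaussLR_pos (u i) _).le]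
    rw [lintegral_finsetSum _ fun i _ => (hGm i).ennreal_ofReal]
    simp [hγ, lintegral_gaussLR, hN]
  have hI2 : ∫⁻ x, ENNReal.ofReal (Λ x ^ 2) ∂γ ≤ ENNReal.ofReal (V * N ^ 2) := by
    have hsq : ∀ x, ENNReal.ofReal (Λ x ^ 2) =
        ∑ i, ∑ j, ENNReal.ofReal (gaussLR (u i) x * gaussLR (u j) x) := fun x => by
      rw [sq, hΛ, Finset.sum_mul_sum, ENNReal.ofReal_sum_of_nonneg fun i _ =>
        Finset.sum_nonneg fun j _ => (mul_pos (gaussLR_pos _ _) (gaussLR_pos _ _)).le]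
      exact Finset.sum_congr rfl fun i _ => ENNReal.ofReal_sum_of_nonneg
        fun j _ => (mul_pos (gaussLR_pos _ _) (gaussLR_pos _ _)).le
    simp_rw [hsq]
    rw [lintegral_finsetSum _ fun i _ => by fun_prop]
    have hi : ∀ i, ∫⁻ x, ∑ j, ENNReal.ofReal (gaussLR (u i) x * gaussLR (u j) x) ∂γ ≤
        ENNReal.ofReal (V * N) := fun i => by
      rw [lintegral_finsetSum _ fun j _ => by fun_prop]
      simp_rw [hγ, lintegral_gaussLR_mul]
      rw [← ENNReal.ofReal_sum_of_nonneg fun j _ => (Real.exp_pos _).le]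
      exact ENNReal.ofReal_le_ofReal (hchi i)
    refine (Finset.sum_le_sum fun i _ => hi i).trans_eq ?_
    rw [Finset.sum_const, Finset.card_univ, nsmul_eq_mul, ← ENNReal.ofReal_natCast,
      ← ENNReal.ofReal_mul (Nat.cast_nonneg _)]
    congr 1
    rw [← hN]; ring
  have hI3 : ∫⁻ x, ENNReal.ofReal (Λ x * (S x - Δ) ^ 2) ∂γ ≤ ENNReal.ofReal N * R := by
    have hsum : ∀ x, ENNReal.ofReal (Λ x * (S x - Δ) ^ 2) =
        ∑ i, ENNReal.ofReal (gaussLR (u i) x * (S x - Δ) ^ 2) := fun x => by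
      rw [hΛ, Finset.sum_mul, ENNReal.ofReal_sum_of_nonneg fun i _ =>
        mul_nonneg (gaussLR_pos _ _).le (sq_nonneg _)]
    simp_rw [hsum]
    rw [lintegral_finsetSum _ fun i _ => by fun_prop]
    refine (Finset.sum_le_sum fun i _ => hRi i).trans_eq ?_
    rw [Finset.sum_const, Finset.card_univ, nsmul_eq_mul, hN, ENNReal.ofReal_natCast]
  -- This value maximises the bound `ρ ≥ (2tΔ - (V + 1)) / (2t²)` obtained from `key2`.
  set t : ℝ := (V + 1) / Δ with ht
  have htpos : 0 < t := by positivity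
  -- Adding the two squares cancels the cross terms `2tNΛS`. Every remaining term is nonnegative, so
  -- the inequality integrates in `ℝ≥0∞` without integrability conditions.
  have hpt : ∀ x, 2 * t * Δ * N * Λ x ≤
      t ^ 2 * N ^ 2 * S x ^ 2 + Λ x ^ 2 + t ^ 2 * N * (Λ x * (S x - Δ) ^ 2) + N * Λ x := fun x => by
    nlinarith [sq_nonneg (t * N * S x - Λ x),
      mul_nonneg (mul_nonneg hNpos.le (hΛ0 x)) (sq_nonneg (t * (S x - Δ) + 1))]
  have key : ENNReal.ofReal (2 * t * Δ * N) * ENNReal.ofReal N ≤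
      ENNReal.ofReal (t ^ 2 * N ^ 2) * R + ENNReal.ofReal (V * N ^ 2) +
        ENNReal.ofReal (t ^ 2 * N) * (ENNReal.ofReal N * R) +
        ENNReal.ofReal N * ENNReal.ofReal N := by
    calc ENNReal.ofReal (2 * t * Δ * N) * ENNReal.ofReal N
        = ∫⁻ x, ENNReal.ofReal (2 * t * Δ * N * Λ x) ∂γ := by
          simp_rw [ENNReal.ofReal_mul (show 0 ≤ 2 * t * Δ * N by positivity)]
          rw [lintegral_const_mul _ hΛm.ennreal_ofReal, hI1]
      _ ≤ ∫⁻ x, (ENNReal.ofReal (t ^ 2 * N ^ 2) * ENNReal.ofReal (S x ^ 2)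
            + ENNReal.ofReal (Λ x ^ 2)
            + ENNReal.ofReal (t ^ 2 * N) * ENNReal.ofReal (Λ x * (S x - Δ) ^ 2)
            + ENNReal.ofReal N * ENNReal.ofReal (Λ x)) ∂γ := by
          refine lintegral_mono fun x => ?_
          refine (ENNReal.ofReal_le_ofReal (hpt x)).trans_eq ?_
          have := hΛ0 x
          rw [ENNReal.ofReal_add (by positivity) (by positivity),
            ENNReal.ofReal_add (by positivity) (by positivity),
            ENNReal.ofReal_add (by positivity) (by positivity),
            ENNReal.ofReal_mul (p := t ^ 2 * N ^ 2) (by positivity),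
            ENNReal.ofReal_mul (p := t ^ 2 * N) (by positivity),
            ENNReal.ofReal_mul (p := N) (by positivity)]
      _ = ENNReal.ofReal (t ^ 2 * N ^ 2) * ∫⁻ x, ENNReal.ofReal (S x ^ 2) ∂γ
            + ∫⁻ x, ENNReal.ofReal (Λ x ^ 2) ∂γ
            + ENNReal.ofReal (t ^ 2 * N) * ∫⁻ x, ENNReal.ofReal (Λ x * (S x - Δ) ^ 2) ∂γ
            + ENNReal.ofReal N * ∫⁻ x, ENNReal.ofReal (Λ x) ∂γ := by
          rw [lintegral_add_left (by fun_prop), lintegral_add_left (by fun_prop),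
            lintegral_add_left (by fun_prop), lintegral_const_mul _ (by fun_prop),
            lintegral_const_mul _ (by fun_prop), lintegral_const_mul _ (by fun_prop)]
      _ ≤ _ := by rw [hI1]; gcongr
  rw [← ENNReal.ofReal_toReal htop] at key ⊢
  set ρ := R.toReal with hρ
  have hρ0 : 0 ≤ ρ := ENNReal.toReal_nonneg
  rw [← ENNReal.ofReal_mul (by positivity), ← ENNReal.ofReal_mul (by positivity),
    ← ENNReal.ofReal_mul (by positivity), ← ENNReal.ofReal_mul (by positivity),
    ← ENNReal.ofReal_mul (by positivity), ← ENNReal.ofReal_add (by positivity) (by positivity),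
    ← ENNReal.ofReal_add (by positivity) (by positivity),
    ← ENNReal.ofReal_add (by positivity) (by positivity),
    ENNReal.ofReal_le_ofReal_iff (by positivity)] at key
  refine ENNReal.ofReal_le_ofReal ?_
  have key2 : 2 * t * Δ ≤ 2 * t ^ 2 * ρ + (V + 1) := by
    refine le_of_mul_le_mul_right ?_ (show 0 < N ^ 2 by positivity)
    linarith
  have e1 : 2 * t * Δ = 2 * (V + 1) := by rw [ht]; field_simp
  have e2 : 2 * t ^ 2 * ρ = 2 * (V + 1) ^ 2 * ρ / Δ ^ 2 := by rw [ht]; field_simp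
  have key3 : V + 1 ≤ 2 * (V + 1) ^ 2 * ρ / Δ ^ 2 := by linarith
  rw [le_div_iff₀ (by positivity)] at key3
  rw [div_le_iff₀ (by positivity)]
  refine le_of_mul_le_mul_left ?_ (show 0 < V + 1 by positivity)
  linarith


/-! ### Block spikes and their second moment -/

/-- The set of spike locations that takes position `g k` in the `k`-th of `s` disjoint blocks of
length `b`. -/
def blockSupport {s b d : ℕ} (e : Fin s × Fin b ↪ Fin d) (g : Fin s → Fin b) : Finset (Fin d) :=
  Finset.univ.image fun k => e (k, g k)

lemma blockSupport_injective {s b d : ℕ} (e : Fin s × Fin b ↪ Fin d) (g : Fin s → Fin b) :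
    Function.Injective fun k => e (k, g k) :=
  fun _ _ h => congrArg Prod.fst (e.injective h)

/-- The vector that equals `ρ` on `blockSupport e g` and `0` elsewhere. -/
def blockSpikes {s b d : ℕ} (e : Fin s × Fin b ↪ Fin d) (ρ : ℝ) (g : Fin s → Fin b) :
    Fin d → ℝ := fun i => if i ∈ blockSupport e g then ρ else 0

lemma card_blockSupport {s b d : ℕ} (e : Fin s × Fin b ↪ Fin d) (g : Fin s → Fin b) :
    (blockSupport e g).card = s := by
  rw [blockSupport, Finset.card_image_of_injective _ (blockSupport_injective e g),
    Finset.card_univ, Fintype.card_fin]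

lemma sum_comp_blockSpikes {s b d : ℕ} (e : Fin s × Fin b ↪ Fin d) (ρ : ℝ) (g : Fin s → Fin b)
    {F : ℝ → ℝ} (hF : F 0 = 0) : ∑ i, F (blockSpikes e ρ g i) = s * F ρ := by
  simp only [blockSpikes, apply_ite F, hF]
  rw [Finset.sum_ite_mem, Finset.univ_inter, Finset.sum_const, card_blockSupport, nsmul_eq_mul]

lemma sum_blockSpikes_mul {s b d : ℕ} (e : Fin s × Fin b ↪ Fin d) (ρ : ℝ)
    (g g' : Fin s → Fin b) :
    ∑ i, blockSpikes e ρ g i * blockSpikes e ρ g' i =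
      ∑ k, if g k = g' k then ρ ^ 2 else 0 := by
  simp only [blockSpikes, ite_mul, zero_mul]
  rw [Finset.sum_ite_mem, Finset.univ_inter]
  conv_lhs => rw [blockSupport, Finset.sum_image (blockSupport_injective e g).injOn]
  refine Finset.sum_congr rfl fun k _ => ?_
  have : e (k, g k) ∈ blockSupport e g' ↔ g k = g' k := by
    simp only [blockSupport, Finset.mem_image, Finset.mem_univ, true_and,
      EmbeddingLike.apply_eq_iff_eq, Prod.mk.injEq]
    constructor
    · rintro ⟨a, rfl, h⟩; exact h.symm
    · exact fun h => ⟨k, rfl, h.symm⟩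
  simp only [this]
  split_ifs <;> ring

lemma sum_exp_agreements {s b : ℕ} (a : ℝ) (g : Fin s → Fin b) :
    ∑ g' : Fin s → Fin b, Real.exp (∑ k, if g k = g' k then a else 0) =
      (b - 1 + Real.exp a) ^ s := by
  simp_rw [Real.exp_sum]
  rw [← Fintype.prod_sum (fun k j => Real.exp (if g k = j then a else 0))]
  have : ∀ k, ∑ j, Real.exp (if g k = j then a else 0) = b - 1 + Real.exp a := fun k => by
    have h : ∀ j, Real.exp (if g k = j then a else 0) =
        1 + if g k = j then Real.exp a - 1 else 0 := fun j => by split_ifs <;> simp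
    simp_rw [h, Finset.sum_add_distrib]
    simp
    ring
  simp [this]

/-- Since `d/s² ≤ 2b/s`, the base is at most `b(1 + 2/s) ≤ b exp(2/s)`, and `exp 2 ≤ 9`. -/
lemma block_length_pow_le {s b d : ℕ} (hs : 1 ≤ s) (hd : d ≤ 2 * (s * b)) {x : ℝ} (hx0 : 0 ≤ x)
    (hx : x ≤ 1 + (d : ℝ) / (s : ℝ) ^ 2) (hb : 1 ≤ b) :
    ((b : ℝ) - 1 + x) ^ s ≤ 9 * (b : ℝ) ^ s := by
  have hs' : (1 : ℝ) ≤ s := by exact_mod_cast hs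
  have hb' : (1 : ℝ) ≤ b := by exact_mod_cast hb
  have hd' : (d : ℝ) ≤ 2 * (s * b) := by exact_mod_cast hd
  have h1 : (d : ℝ) / (s : ℝ) ^ 2 ≤ b * (2 / s) := by
    rw [div_le_iff₀ (by positivity)]
    calc (d : ℝ) ≤ 2 * (s * b) := hd'
      _ = b * (2 / s) * (s : ℝ) ^ 2 := by field_simp
  have h2 : (b : ℝ) - 1 + x ≤ b * Real.exp (2 / s) := by
    have := Real.add_one_le_exp (2 / (s : ℝ))
    nlinarith
  have h3 : Real.exp (2 / s) ^ s ≤ 9 := by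
    rw [← Real.exp_nat_mul, mul_div_cancel₀ _ (by positivity)]
    have h := Real.exp_one_lt_d9
    have h' : Real.exp 2 = Real.exp 1 * Real.exp 1 := by rw [← Real.exp_add]; norm_num
    nlinarith [Real.exp_pos 1]
  calc ((b : ℝ) - 1 + x) ^ s ≤ (b * Real.exp (2 / s)) ^ s :=
        pow_le_pow_left₀ (by linarith) h2 s
    _ = Real.exp (2 / s) ^ s * (b : ℝ) ^ s := by rw [mul_pow, mul_comm]
    _ ≤ 9 * (b : ℝ) ^ s := by gcongr

lemma zero_mem_lqBall {d : ℕ} {q r : ℝ} (hq : 0 < q) (hr : 0 < r) :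
    (0 : Fin d → ℝ) ∈ lqBall d q r := by
  simp [lqBall, Real.zero_rpow hq.ne', Real.zero_rpow (inv_ne_zero hq.ne'), hr.le]

lemma blockSpikes_mem_lqBall {s b d : ℕ} (e : Fin s × Fin b ↪ Fin d) {q r ρ : ℝ} (hq : 0 < q)
    (hρ : 0 < ρ) (hr : (s : ℝ) ^ (1 / q) * ρ ≤ r) (g : Fin s → Fin b) :
    blockSpikes e ρ g ∈ lqBall d q r := by
  have h := sum_comp_blockSpikes e ρ g (F := fun x => |x| ^ q) (by simp [Real.zero_rpow hq.ne'])
  simp only [lqBall, Set.mem_ofPred_eq]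
  rw [h, abs_of_pos hρ, Real.mul_rpow (Nat.cast_nonneg s) (by positivity),
    ← Real.rpow_mul hρ.le, mul_one_div_cancel hq.ne', Real.rpow_one]
  exact hr

/-- Lower bound from `s` spikes of height `ρ` that cannot be detected. -/
lemma spikes_le_minimaxRisk {d s : ℕ} (hs : 1 ≤ s) (hsd : s ≤ d) {σ q r ρ : ℝ} (hσ : 0 < σ)
    (hq : 0 < q) (hρ : 0 < ρ) (hdet : ρ ^ 2 ≤ σ ^ 2 * Real.log (1 + (d : ℝ) / (s : ℝ) ^ 2))
    (hr : (s : ℝ) ^ (1 / q) * ρ ≤ r) :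
    ENNReal.ofReal ((s * ρ) ^ 2 / 20) ≤ minimaxRisk σ linFun (lqBall d q r) := by
  have hs' : (1 : ℝ) ≤ s := by exact_mod_cast hs
  have hr0 : 0 < r := lt_of_lt_of_le (by positivity) hr
  set b := d / s with hb
  have hb1 : 1 ≤ b := (Nat.one_le_div_iff hs).2 hsd
  have hsb : s * b ≤ d := Nat.mul_div_le d s
  have hd2 : d ≤ 2 * (s * b) := by
    have h1 : d < s * (b + 1) := Nat.lt_mul_div_succ d hs
    nlinarith
  let e : Fin s × Fin b ↪ Fin d := finProdFinEquiv.toEmbedding.trans (Fin.castLEEmb hsb)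
  have : Nonempty (Fin b) := ⟨⟨0, hb1⟩⟩
  have key := le_minimaxRisk_of_mixture (L := linFun) hσ (by simp [linFun])
    (zero_mem_lqBall (d := d) hq hr0) (blockSpikes e ρ)
    (blockSpikes_mem_lqBall e hq hρ hr) (Δ := s * ρ) (by positivity)
    (fun g => sum_comp_blockSpikes e ρ g (F := fun x => x) rfl) (V := 9) (by norm_num) ?_
  · norm_num at key ⊢
    exact key
  intro g
  have hinner : ∀ g', ∑ k, blockSpikes e ρ g k / σ * (blockSpikes e ρ g' k / σ) =
      ∑ k, if g k = g' k then ρ ^ 2 / σ ^ 2 else 0 := fun g' => by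
    have h : ∀ k, blockSpikes e ρ g k / σ * (blockSpikes e ρ g' k / σ) =
        blockSpikes e ρ g k * blockSpikes e ρ g' k / σ ^ 2 := fun k => by field_simp
    simp_rw [h]
    rw [← Finset.sum_div, sum_blockSpikes_mul, Finset.sum_div]
    exact Finset.sum_congr rfl fun k _ => by split_ifs <;> simp
  simp_rw [hinner]
  rw [sum_exp_agreements]
  have hx : Real.exp (ρ ^ 2 / σ ^ 2) ≤ 1 + (d : ℝ) / (s : ℝ) ^ 2 := by
    rw [← Real.le_log_iff_exp_le (by positivity), div_le_iff₀ (by positivity)]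
    linarith
  simpa using block_length_pow_le hs hd2 (Real.exp_pos _).le hx hb1

/-! ### Admissible sparsities and the resulting rates -/

lemma rpow_mul_le_of_mem_sparsitySet {d s : ℕ} {σ q r : ℝ} (hr : 0 < r)
    (hs : s ∈ sparsitySet σ q r d) :
    (s : ℝ) ^ (1 / q) * (σ * √(Real.log (1 + (d : ℝ) / (s : ℝ) ^ 2))) ≤ r := by
  obtain ⟨h1, h2⟩ := hs
  have hs' : (0 : ℝ) < s := by exact_mod_cast h1
  have hlog : 0 ≤ Real.log (1 + (d : ℝ) / (s : ℝ) ^ 2) :=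
    Real.log_nonneg (le_add_of_nonneg_right (by positivity))
  refine le_of_sq_le_sq ?_ hr.le
  have e1 : ((s : ℝ) ^ (1 / q)) ^ 2 = (s : ℝ) ^ (2 / q) := by
    rw [← Real.rpow_natCast, ← Real.rpow_mul hs'.le]; congr 1; push_cast; ring
  have e2 : (s : ℝ) ^ (2 / q) * (s : ℝ) ^ (-2 / q) = 1 := by
    rw [← Real.rpow_add hs', neg_div, add_neg_cancel, Real.rpow_zero]
  rw [mul_pow, mul_pow, Real.sq_sqrt hlog, e1]
  calc (s : ℝ) ^ (2 / q) * (σ ^ 2 * Real.log (1 + (d : ℝ) / (s : ℝ) ^ 2))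
      ≤ (s : ℝ) ^ (2 / q) * (r ^ 2 * (s : ℝ) ^ (-2 / q)) := by gcongr
    _ = r ^ 2 * ((s : ℝ) ^ (2 / q) * (s : ℝ) ^ (-2 / q)) := by ring
    _ = r ^ 2 := by rw [e2, mul_one]

/-- More than `d` spikes do not fit in `d` coordinates, so `m` must be replaced by `d`. Bernoulli's
inequality with exponent `k = (m/d)²` compares the logarithms; `q ≤ 1` makes `s ^ (2 - 2/q)`
nonincreasing in `s`, which absorbs the factor `k`. -/
lemma dim_mem_sparsitySet {d m : ℕ} (hd : 1 ≤ d) (hdm : d ≤ m) {σ q r : ℝ} (hq0 : 0 < q)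
    (hq1 : q ≤ 1) (hm : m ∈ sparsitySet σ q r d) : d ∈ sparsitySet σ q r d := by
  obtain ⟨-, h2⟩ := hm
  have hd' : (1 : ℝ) ≤ d := by exact_mod_cast hd
  have hdm' : (d : ℝ) ≤ m := by exact_mod_cast hdm
  have hm' : (0 : ℝ) < m := by linarith
  refine ⟨hd, ?_⟩
  set k : ℝ := (m : ℝ) ^ 2 / (d : ℝ) ^ 2 with hk
  have hk1 : 1 ≤ k := by
    rw [hk, one_le_div (by positivity)]; gcongr
  have hx : (0 : ℝ) ≤ (d : ℝ) / (m : ℝ) ^ 2 := by positivity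
  have hlog : Real.log (1 + (d : ℝ) / (d : ℝ) ^ 2) ≤
      k * Real.log (1 + (d : ℝ) / (m : ℝ) ^ 2) := by
    rw [← Real.log_rpow (by positivity)]
    refine Real.log_le_log (by positivity) ?_
    convert one_add_mul_self_le_rpow_one_add (s := (d : ℝ) / (m : ℝ) ^ 2) (by linarith) hk1 using 2
    rw [hk]; field_simp
  have hpow : k * (m : ℝ) ^ (-2 / q) ≤ (d : ℝ) ^ (-2 / q) := by
    have hmono : (m : ℝ) ^ (2 + -2 / q) ≤ (d : ℝ) ^ (2 + -2 / q) := by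
      refine Real.rpow_le_rpow_of_nonpos (by linarith) hdm' ?_
      have : 2 ≤ 2 / q := by rw [le_div_iff₀ hq0]; linarith
      rw [neg_div]; linarith
    rw [Real.rpow_add hm', Real.rpow_add (by linarith), Real.rpow_two, Real.rpow_two] at hmono
    rw [hk, div_mul_eq_mul_div, div_le_iff₀ (by positivity)]
    linarith
  calc σ ^ 2 * Real.log (1 + (d : ℝ) / (d : ℝ) ^ 2)
      ≤ σ ^ 2 * (k * Real.log (1 + (d : ℝ) / (m : ℝ) ^ 2)) := by gcongr
    _ = k * (σ ^ 2 * Real.log (1 + (d : ℝ) / (m : ℝ) ^ 2)) := by ring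
    _ ≤ k * (r ^ 2 * (m : ℝ) ^ (-2 / q)) := by gcongr
    _ = r ^ 2 * (k * (m : ℝ) ^ (-2 / q)) := by ring
    _ ≤ r ^ 2 * (d : ℝ) ^ (-2 / q) := by gcongr

lemma le_minimaxRisk_of_mem_sparsitySet {d s : ℕ} (hd : 1 ≤ d) (hsd : s ≤ d) {σ q r : ℝ}
    (hσ : 0 < σ) (hq : 0 < q) (hr : 0 < r) (hs : s ∈ sparsitySet σ q r d) :
    ENNReal.ofReal (σ ^ 2 * (s : ℝ) ^ 2 * Real.log (1 + (d : ℝ) / (s : ℝ) ^ 2) / 20) ≤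
      minimaxRisk σ linFun (lqBall d q r) := by
  have hs' : (0 : ℝ) < s := by exact_mod_cast hs.1
  have hd' : (0 : ℝ) < d := by exact_mod_cast hd
  have hlog : 0 < Real.log (1 + (d : ℝ) / (s : ℝ) ^ 2) :=
    Real.log_pos (lt_add_of_pos_right _ (by positivity))
  have hsq : (σ * √(Real.log (1 + (d : ℝ) / (s : ℝ) ^ 2))) ^ 2 =
      σ ^ 2 * Real.log (1 + (d : ℝ) / (s : ℝ) ^ 2) := by
    rw [mul_pow, Real.sq_sqrt hlog.le]
  have h := spikes_le_minimaxRisk hs.1 hsd hσ hq (mul_pos hσ (Real.sqrt_pos.2 hlog)) hsq.le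
    (rpow_mul_le_of_mem_sparsitySet hr hs)
  rw [mul_pow, hsq] at h
  convert h using 3
  ring

lemma dense_le_minimaxRisk {d m : ℕ} (hd : 1 ≤ d) (hdm : d ≤ m) {σ q r : ℝ} (hσ : 0 < σ)
    (hq0 : 0 < q) (hq1 : q ≤ 1) (hr : 0 < r) (hm : m ∈ sparsitySet σ q r d) :
    ENNReal.ofReal (σ ^ 2 * d / 40) ≤ minimaxRisk σ linFun (lqBall d q r) := by
  refine le_trans (ENNReal.ofReal_le_ofReal ?_) (le_minimaxRisk_of_mem_sparsitySet hd le_rfl hσ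
    hq0 hr (dim_mem_sparsitySet hd hdm hq0 hq1 hm))
  have hd' : (1 : ℝ) ≤ d := by exact_mod_cast hd
  -- `log(1 + 1/d) ≥ 1/(d + 1) ≥ 1/(2d)`; this loss of 2 turns 20 into 40.
  have hlog : 1 / (2 * d : ℝ) ≤ Real.log (1 + (d : ℝ) / (d : ℝ) ^ 2) := by
    refine le_trans ?_ (Real.one_sub_inv_le_log_of_pos (by positivity))
    have : 1 - (1 + (d : ℝ) / (d : ℝ) ^ 2)⁻¹ = 1 / ((d : ℝ) + 1) := by field_simp; ring
    rw [this]
    gcongr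
    linarith
  calc σ ^ 2 * d / 40 = σ ^ 2 * (d : ℝ) ^ 2 * (1 / (2 * d)) / 20 := by field_simp; norm_num
    _ ≤ _ := by gcongr

end SparseMinimax

theorem theorem2 (q : ℝ) (hq0 : 0 < q) (hq1 : q ≤ 1) :
    ∃ c : ℝ, 0 < c ∧ ∀ d : ℕ, 1 ≤ d → ∀ r σ : ℝ, 0 < r → 0 < σ →
      ENNReal.ofReal (c * SparseMinimax.linRate σ q r d) ≤
        SparseMinimax.minimaxRisk σ SparseMinimax.linFun (SparseMinimax.lqBall d q r) := by
  refine ⟨1 / 40, by norm_num, fun d hd r σ hr hσ => ?_⟩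
  have hd' : (1 : ℝ) ≤ d := by exact_mod_cast hd
  unfold SparseMinimax.linRate
  split_ifs with hbdd hzero
  -- Failure of the condition at `s = 1` says exactly that a single spike of height `r` is
  -- undetectable.
  · have h1 : 1 ∉ SparseMinimax.sparsitySet σ q r d := fun h => by
      have := le_csSup hbdd h
      rw [SparseMinimax.effSparsity] at hzero
      omega
    have hlt : r ^ 2 < σ ^ 2 * Real.log (1 + (d : ℝ) / ((1 : ℕ) : ℝ) ^ 2) := by
      by_contra! hle
      exact h1 ⟨le_rfl, by simpa using hle⟩
    refine le_trans (ENNReal.ofReal_le_ofReal ?_)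
      (SparseMinimax.spikes_le_minimaxRisk le_rfl hd hσ hq0 hr hlt.le (by simp))
    push_cast
    nlinarith [sq_nonneg r]
  · set m := SparseMinimax.effSparsity σ q r d with hm
    have hmem : m ∈ SparseMinimax.sparsitySet σ q r d := by
      refine Nat.sSup_mem (Set.nonempty_iff_ne_empty.2 fun h => hzero ?_) hbdd
      rw [hm, SparseMinimax.effSparsity, h, csSup_empty, Nat.bot_eq_zero]
    have hm0 : (0 : ℝ) < m := by exact_mod_cast hmem.1
    rcases le_total m d with hmd | hmd
    · refine le_trans (ENNReal.ofReal_le_ofReal ?_)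
        (SparseMinimax.le_minimaxRisk_of_mem_sparsitySet hd hmd hσ hq0 hr hmem)
      have : 0 ≤ σ ^ 2 * (m : ℝ) ^ 2 * Real.log (1 + (d : ℝ) / (m : ℝ) ^ 2) :=
        mul_nonneg (by positivity)
          (Real.log_nonneg (le_add_of_nonneg_right (by positivity)))
      linarith
    · refine le_trans (ENNReal.ofReal_le_ofReal ?_)
        (SparseMinimax.dense_le_minimaxRisk hd hmd hσ hq0 hq1 hr hmem)
      -- By `log(1 + x) ≤ x` the rate never exceeds `σ² d`, which the dense bound supplies.
      have hlog : Real.log (1 + (d : ℝ) / (m : ℝ) ^ 2) ≤ d / (m : ℝ) ^ 2 := by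
        linarith [Real.log_le_sub_one_of_pos (show 0 < 1 + (d : ℝ) / (m : ℝ) ^ 2 by positivity)]
      calc 1 / 40 * (σ ^ 2 * (m : ℝ) ^ 2 * Real.log (1 + (d : ℝ) / (m : ℝ) ^ 2))
          ≤ 1 / 40 * (σ ^ 2 * (m : ℝ) ^ 2 * (d / (m : ℝ) ^ 2)) := by gcongr
        _ = σ ^ 2 * d / 40 := by field_simp
  · obtain ⟨m, hmem, hdm⟩ := not_bddAbove_iff.1 hbdd d
    convert SparseMinimax.dense_le_minimaxRisk hd hdm.le hσ hq0 hq1 hr hmem using 2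
    ring
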